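/- Let $V$ be an operator space, that is, a complex vector space with a norm $\|\cdot\|_{M_n(V)}$ on each space $M_n(V)$ of $n\times n$ matrices over $V$ such that $\|A\cdot X\cdot B^*\|_{M_p(V)}\le\|A\|\,\|X\|_{M_n(V)}\,\|B\|$ for all $X\in M_n(V)$ and $A,B\in M_{p,n}(\mathbb C)$, and $\|X\oplus Y\|_{M_{n+p}(V)}=\max\{\|X\|_{M_n(V)},\|Y\|_{M_p(V)}\}$ for all $X\in M_n(V)$, $Y\in M_p(V)$. Here $A\cdot X\cdot B^*=\big(\sum_{a,b}A_{ia}\overline{B_{jb}}\,X_{ab}\big)_{i,j}$ and scalar matrices carry the operator norm. For an integer $k\ge 1$ and $X=(X_{ij})\in M_m(V)$ let $$\|X\|_{M_m(MAX^k(V))}=\sup\big\{\|(\Phi(X_{ij}))\| : \mathcal H \text{ a complex Hilbert space},\ \Phi:V\to\mathcal B(\mathcal H)\text{ linear},\ \|id_k\otimes\Phi\|\le 1\big\},$$ where $M_n(\mathcal B(\mathcal H))$ is normed as $\mathcal B(\mathcal H^n)$ and $\|id_k\otimes\Phi\|$ is the norm of the map $(Y_{ij})\mapsto(\Phi(Y_{ij}))$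 from $M_k(V)$ to $M_k(\mathcal B(\mathcal H))$. Then for every integer $k\ge1$ and every $X\in M_m(V)$ this supremum is finite, $X$ has at least one factorization of the form below, and $$\|X\|_{M_m(MAX^k(V))}=\inf\big\{\|A\|\,\|B\| : r\ge 1,\ A,B\in M_{m,rk}(\mathbb C),\ x_1,\dots,x_r\in M_k(V),\ \|x_s\|_{M_k(V)}\le 1,\ X=A\cdot\mathrm{diag}(x_1,\dots,x_r)\cdot B^*\big\},$$ where $\mathrm{diag}(x_1,\dots,x_r)\in M_{rk}(V)$ is the block diagonal matrix with diagonal blocks $x_1,\dots,x_r$. -/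

import Mathlib

open scoped Matrix.Norms.L2Operator ENNReal

universe u w

/-- `A · X · B*` for scalar matrices `A`, `B` and a matrix `X` with entries in a complex vector
space: the `(i, j)` entry is `∑ a b, A i a * conj (B j b) • X a b`. -/
def sandwich {V : Type u} [AddCommGroup V] [Module ℂ V] {p n : Type*} [Fintype n]
    (A : Matrix p n ℂ) (X : Matrix n n V) (B : Matrix p n ℂ) : Matrix p p V :=
  Matrix.of fun i j => ∑ a, ∑ b, (A i a * star (B j b)) • X a b

/-- The direct sum `X ⊕ Y ∈ M_{m+p}(V)` of `X ∈ M_m(V)` and `Y ∈ M_p(V)`. -/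
def matrixDirectSum {V : Type u} [AddCommGroup V] {m p : ℕ}
    (X : Matrix (Fin m) (Fin m) V) (Y : Matrix (Fin p) (Fin p) V) :
    Matrix (Fin (m + p)) (Fin (m + p)) V :=
  Matrix.reindex finSumFinEquiv finSumFinEquiv (Matrix.fromBlocks X 0 0 Y)

/-- An (abstract) operator space structure on a complex vector space `V`: a norm on each
`M_n(V)`, such that the family is a matrix norm with the `L^∞` property. Scalar matrices carry the
operator norm with respect to the Euclidean norms. The degenerate size `n = 0` adds nothing, since
`M_0(V)` is the zero space. -/
class OperatorSpace (V : Type u) [AddCommGroup V] [Module ℂ V] where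
  matNorm : ∀ n : ℕ, Matrix (Fin n) (Fin n) V → ℝ
  matNorm_nonneg : ∀ (n : ℕ) (X : Matrix (Fin n) (Fin n) V), 0 ≤ matNorm n X
  matNorm_eq_zero_iff : ∀ (n : ℕ) (X : Matrix (Fin n) (Fin n) V), matNorm n X = 0 ↔ X = 0
  matNorm_smul : ∀ (n : ℕ) (c : ℂ) (X : Matrix (Fin n) (Fin n) V),
    matNorm n (c • X) = ‖c‖ * matNorm n X
  matNorm_add_le : ∀ (n : ℕ) (X Y : Matrix (Fin n) (Fin n) V),
    matNorm n (X + Y) ≤ matNorm n X + matNorm n Y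
  matNorm_sandwich_le : ∀ (p m : ℕ) (A B : Matrix (Fin p) (Fin m) ℂ)
    (X : Matrix (Fin m) (Fin m) V),
    matNorm p (sandwich A X B) ≤ ‖A‖ * matNorm m X * ‖B‖
  matNorm_directSum : ∀ (m p : ℕ) (X : Matrix (Fin m) (Fin m) V) (Y : Matrix (Fin p) (Fin p) V),
    matNorm (m + p) (matrixDirectSum X Y) = max (matNorm m X) (matNorm p Y)

noncomputable section

/-- The operator on the Hilbert space direct sum `H^m` given by an `m × m` matrix of bounded
operators on `H`; this is the identification of `M_m(B(H))` with `B(H^m)`. -/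
def opMatrix {H : Type w} [NormedAddCommGroup H] [InnerProductSpace ℂ H] {m : ℕ}
    (T : Matrix (Fin m) (Fin m) (H →L[ℂ] H)) :
    PiLp 2 (fun _ : Fin m => H) →L[ℂ] PiLp 2 (fun _ : Fin m => H) :=
  ((PiLp.continuousLinearEquiv 2 ℂ (fun _ : Fin m => H)).symm :
      (Fin m → H) →L[ℂ] PiLp 2 (fun _ : Fin m => H)) ∘L
    ContinuousLinearMap.pi fun i => ∑ j, (T i j) ∘L (PiLp.proj 2 (fun _ : Fin m => H) j)

theorem opMatrix_apply {H : Type w} [NormedAddCommGroup H] [InnerProductSpace ℂ H] {m : ℕ}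
    (T : Matrix (Fin m) (Fin m) (H →L[ℂ] H)) (x : PiLp 2 (fun _ : Fin m => H)) (i : Fin m) :
    opMatrix T x i = ∑ j, T i j (x j) := by
  simp [opMatrix]

/-- The norm of `id_k ⊗ Φ : M_k(V) → M_k(B(H))`, with values in `[0, ∞]`. -/
def ampNorm {V : Type u} [AddCommGroup V] [Module ℂ V] [OperatorSpace V]
    {H : Type w} [NormedAddCommGroup H] [InnerProductSpace ℂ H]
    (k : ℕ) (Φ : V →ₗ[ℂ] (H →L[ℂ] H)) : ℝ≥0∞ :=
  ⨆ (Y : Matrix (Fin k) (Fin k) V) (_ : OperatorSpace.matNorm k Y ≤ 1),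
    ENNReal.ofReal ‖opMatrix (Y.map Φ)‖

/-- The values `‖(Φ(X_{ij}))‖`, where `Φ` runs over the linear maps from `V` into the bounded
operators on some complex Hilbert space such that `‖id_k ⊗ Φ‖ ≤ 1`. -/
def kMaxValues {V : Type u} [AddCommGroup V] [Module ℂ V] [OperatorSpace V]
    (k : ℕ) {m : ℕ} (X : Matrix (Fin m) (Fin m) V) : Set ℝ :=
  {c | ∃ (H : Type w) (_ : NormedAddCommGroup H) (_ : InnerProductSpace ℂ H)
      (_ : CompleteSpace H) (Φ : V →ₗ[ℂ] (H →L[ℂ] H)),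
      ampNorm k Φ ≤ 1 ∧ c = ‖opMatrix (X.map Φ)‖}

/-- The norm of `X` in `M_m(MAX^k(V))`. -/
def kMaxNorm {V : Type u} [AddCommGroup V] [Module ℂ V] [OperatorSpace V]
    (k : ℕ) {m : ℕ} (X : Matrix (Fin m) (Fin m) V) : ℝ :=
  sSup (kMaxValues.{u, w} k X)

/-- The numbers `‖A‖ ‖B‖` over all factorizations `X = A · diag(x_1, …, x_r) · B*` with `r ≥ 1`,
`A, B ∈ M_{m,rk}` and `x_1, …, x_r` in the unit ball of `M_k(V)`. The `rk` columns are labelled by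
pairs (position inside a block, number of the block), as in `Matrix.blockDiagonal`. -/
def factorizationValues {V : Type u} [AddCommGroup V] [Module ℂ V] [OperatorSpace V]
    (k : ℕ) {m : ℕ} (X : Matrix (Fin m) (Fin m) V) : Set ℝ :=
  {c | ∃ (r : ℕ) (_ : 1 ≤ r) (A B : Matrix (Fin m) (Fin k × Fin r) ℂ)
      (x : Fin r → Matrix (Fin k) (Fin k) V),
      (∀ s, OperatorSpace.matNorm k (x s) ≤ 1) ∧
      X = sandwich A (Matrix.blockDiagonal x) B ∧ c = ‖A‖ * ‖B‖}

end

/-! Upper bound: if X = ∑ a_s x_s b_s* and `id_k ⊗ Φ` is contractive, then ⟨η, Φ(X)ξ⟩ = ∑ ⟨a_s* η,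
Φ(x_s) b_s* ξ⟩, and Cauchy–Schwarz over the blocks bounds this by ‖A‖‖B‖‖η‖‖ξ‖
(`norm_opMatrix_map_le_of_factorization`).

Lower bound, by duality: the triples (P, Q, Y) with Y = ∑ a_s x_s b_s*, ∑ a_s a_s* ≤ P and ∑ b_s
b_s* ≤ Q form a convex cone. M. Riesz extension gives real functionals with 2h(Y) ≤ p(P) + q(Q) on
the cone, p(1) + q(1) = 2 and h(X) equal to the infimum (`exists_functional_dominated`). Both p and
q are positive, so up to ε they come from invertible densities S*S and T*T
(`exists_isUnit_frobeniusSq_mul_eq`). A GNS-like construction writes h as the real part of a vector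
functional of some Φ on a finite-dimensional space, with the columns of S and T as vectors; the
domination says exactly that `id_k ⊗ Φ` is contractive (`exists_representation_of_dominated`). The
vectors have norm product at most 1 + εm, so ‖Φ(X)‖ nearly attains the infimum; then ε → 0. -/

noncomputable section

/-! ### Block sums and the pairing of sandwiches with vectors -/

/-- The action of `A*` on vectors with entries in a complex vector space. -/
def adjointAct {p n : Type*} [Fintype p] {H : Type w} [NormedAddCommGroup H]
    [InnerProductSpace ℂ H] (A : Matrix p n ℂ) (η : PiLp 2 (fun _ : p => H)) :
    PiLp 2 (fun _ : n => H) :=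
  WithLp.toLp 2 fun c => ∑ i, star (A i c) • η i

@[simp] theorem adjointAct_apply {p n : Type*} [Fintype p] {H : Type w} [NormedAddCommGroup H]
    [InnerProductSpace ℂ H] (A : Matrix p n ℂ) (η : PiLp 2 (fun _ : p => H)) (c : n) :
    adjointAct A η c = ∑ i, star (A i c) • η i := rfl

/-- The columns of a matrix with block-indexed columns that belong to the block `s`. -/
def blockColumns {p n r : Type*} (A : Matrix p (n × r) ℂ) (s : r) : Matrix p n ℂ :=
  Matrix.of fun i c => A i (c, s)

theorem sandwich_blockDiagonal {V : Type u} [AddCommGroup V] [Module ℂ V] {p n r : Type*}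
    [Fintype n] [Fintype r] [DecidableEq r] (A B : Matrix p (n × r) ℂ)
    (x : r → Matrix n n V) :
    sandwich A (Matrix.blockDiagonal x) B =
      ∑ s, sandwich (blockColumns A s) (x s) (blockColumns B s) := by
  ext i j
  simp only [sandwich, blockColumns, Matrix.of_apply, Matrix.sum_apply, Fintype.sum_prod_type,
    Matrix.blockDiagonal_apply, smul_ite, smul_zero, Finset.sum_ite_eq, Finset.mem_univ, if_true]
  rw [Finset.sum_comm]

section Inner

variable {V : Type u} [AddCommGroup V] [Module ℂ V] {H : Type w} [NormedAddCommGroup H]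
  [InnerProductSpace ℂ H]

theorem inner_opMatrix {m : ℕ} (T : Matrix (Fin m) (Fin m) (H →L[ℂ] H))
    (η ξ : PiLp 2 (fun _ : Fin m => H)) :
    inner ℂ η (opMatrix T ξ) = ∑ i, ∑ j, inner ℂ (η i) (T i j (ξ j)) := by
  simp [PiLp.inner_apply, opMatrix_apply, inner_sum]

/-- Scalar coefficients move onto the vectors. Both inequalities rest on this identity. -/
theorem inner_opMatrix_map_sandwich {m k : ℕ} (Φ : V →ₗ[ℂ] (H →L[ℂ] H))
    (a b : Matrix (Fin m) (Fin k) ℂ) (x : Matrix (Fin k) (Fin k) V)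
    (η ξ : PiLp 2 (fun _ : Fin m => H)) :
    inner ℂ η (opMatrix ((sandwich a x b).map Φ) ξ) =
      inner ℂ (adjointAct a η) (opMatrix (x.map Φ) (adjointAct b ξ)) := by
  simp only [inner_opMatrix, adjointAct_apply, Matrix.map_apply, sandwich, Matrix.of_apply,
    map_sum, map_smul, _root_.sum_apply, _root_.smul_apply,
    inner_sum, sum_inner, inner_smul_left, inner_smul_right, Finset.mul_sum]
  refine ((Finset.sum_congr rfl fun i _ => Finset.sum_comm).trans Finset.sum_comm).trans
    (Finset.sum_congr rfl fun c _ => ((Finset.sum_congr rfl fun i _ => Finset.sum_comm).trans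
      Finset.sum_comm).trans (Finset.sum_congr rfl fun d _ => Finset.sum_comm.trans
        (Finset.sum_congr rfl fun j _ => Finset.sum_congr rfl fun i _ => ?_)))
  simp only [starRingEnd_apply, star_star]
  ring

theorem opMatrix_add {m : ℕ} (S T : Matrix (Fin m) (Fin m) (H →L[ℂ] H)) :
    opMatrix (S + T) = opMatrix S + opMatrix T := by
  ext x i
  simp [opMatrix_apply, Finset.sum_add_distrib]

theorem opMatrix_zero {m : ℕ} :
    opMatrix (0 : Matrix (Fin m) (Fin m) (H →L[ℂ] H)) = 0 := by
  ext x i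
  simp [opMatrix_apply]

theorem opMatrix_sum {m : ℕ} {ι : Type*} (s : Finset ι)
    (T : ι → Matrix (Fin m) (Fin m) (H →L[ℂ] H)) :
    opMatrix (∑ t ∈ s, T t) = ∑ t ∈ s, opMatrix (T t) := by
  classical
  induction s using Finset.induction_on with
  | empty => simp [opMatrix_zero]
  | insert a s ha ih => rw [Finset.sum_insert ha, Finset.sum_insert ha, opMatrix_add, ih]

theorem norm_opMatrix_map_le_one [OperatorSpace V] {k : ℕ} {Φ : V →ₗ[ℂ] (H →L[ℂ] H)}
    (hΦ : ampNorm k Φ ≤ 1) {x : Matrix (Fin k) (Fin k) V} (hx : OperatorSpace.matNorm k x ≤ 1) :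
    ‖opMatrix (x.map Φ)‖ ≤ 1 := by
  have h := (le_iSup₂ (f := fun (Y : Matrix (Fin k) (Fin k) V)
    (_ : OperatorSpace.matNorm k Y ≤ 1) => ENNReal.ofReal ‖opMatrix (Y.map Φ)‖) x hx).trans hΦ
  simpa using h

end Inner

/-! ### Scalar matrices acting on Hilbert space valued vectors -/

section Norm

open scoped ComplexOrder MatrixOrder

theorem conjTranspose_mulVec_norm_sq_le {p n : Type*} [Fintype p] [Fintype n] [DecidableEq p]
    [DecidableEq n] (A : Matrix p n ℂ) (α : p → ℂ) :
    ∑ c, ‖∑ i, star (A i c) * α i‖ ^ 2 ≤ ‖A‖ ^ 2 * ∑ i, ‖α i‖ ^ 2 := by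
  have h := Matrix.l2_opNorm_mulVec A.conjTranspose (WithLp.toLp 2 α)
  rw [Matrix.l2_opNorm_conjTranspose] at h
  have h2 := pow_le_pow_left₀ (norm_nonneg _) h 2
  rw [mul_pow, EuclideanSpace.norm_sq_eq, EuclideanSpace.norm_sq_eq] at h2
  simpa [Matrix.mulVec, dotProduct] using h2

theorem l2_opNorm_le_of_conjTranspose_mulVec {p n : Type*} [Fintype p] [Fintype n]
    [DecidableEq p] [DecidableEq n] (A : Matrix p n ℂ) (s : ℝ) (hs : 0 ≤ s)
    (h : ∀ α : p → ℂ, ∑ c, ‖∑ i, star (A i c) * α i‖ ^ 2 ≤ s ^ 2 * ∑ i, ‖α i‖ ^ 2) :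
    ‖A‖ ≤ s := by
  rw [← Matrix.l2_opNorm_conjTranspose, Matrix.l2_opNorm_def]
  refine ContinuousLinearMap.opNorm_le_bound _ hs fun x => ?_
  refine le_of_sq_le_sq ?_ (by positivity)
  rw [mul_pow, EuclideanSpace.norm_sq_eq, EuclideanSpace.norm_sq_eq]
  simpa [Matrix.mulVec, dotProduct] using h x.ofLp

theorem exists_eq_conjTranspose_mul_self {n : Type*} [Fintype n] [DecidableEq n]
    {M : Matrix n n ℂ} (hM : M.PosSemidef) : ∃ N : Matrix n n ℂ, M = N.conjTranspose * N := by
  obtain ⟨N, hN⟩ := CStarAlgebra.nonneg_iff_eq_star_mul_self.1 hM.nonneg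
  exact ⟨N, hN⟩

/-- A Gram identity: the left side depends on M only through M*M, and linearly so. -/
theorem sum_norm_sq_sum_smul {p n : Type*} [Fintype p] [Fintype n]
    {H : Type w} [NormedAddCommGroup H] [InnerProductSpace ℂ H] (M : Matrix n p ℂ) (η : p → H) :
    ((∑ c, ‖∑ i, M c i • η i‖ ^ 2 : ℝ) : ℂ) =
      ∑ i, ∑ j, (M.conjTranspose * M) i j * inner ℂ (η i) (η j) := by
  have key : ∀ v : H, ((‖v‖ : ℂ)) ^ 2 = inner ℂ v v := fun v =>
    (inner_self_eq_norm_sq_to_K (𝕜 := ℂ) v).symm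
  push_cast
  simp only [key, sum_inner, inner_sum, inner_smul_left,
    inner_smul_right, Matrix.mul_apply, Finset.sum_mul, Finset.mul_sum,
    Matrix.conjTranspose_apply]
  refine ((Finset.sum_congr rfl fun c _ => Finset.sum_comm).trans Finset.sum_comm).trans
    (Finset.sum_congr rfl fun i _ => Finset.sum_comm.trans
      (Finset.sum_congr rfl fun j _ => Finset.sum_congr rfl fun c _ => ?_))
  simp only [starRingEnd_apply]
  ring

/-- For scalar vectors this says ‖A‖² − AA* is positive semidefinite. Writing it as N*N, the Gram
identity turns ‖A‖²‖η‖² − ‖A*η‖² into a sum of squares ‖(Nη)_c‖². -/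
theorem norm_adjointAct_le {p n : Type*} [Fintype p] [Fintype n] [DecidableEq p] [DecidableEq n]
    {H : Type w} [NormedAddCommGroup H] [InnerProductSpace ℂ H]
    (A : Matrix p n ℂ) (η : PiLp 2 (fun _ : p => H)) : ‖adjointAct A η‖ ≤ ‖A‖ * ‖η‖ := by
  have hpos : (((‖A‖ ^ 2 : ℝ) : ℂ) • (1 : Matrix p p ℂ) - A * A.conjTranspose).PosSemidef := by
    refine Matrix.PosSemidef.of_dotProduct_mulVec_nonneg ?_ fun α => ?_
    · refine Matrix.IsHermitian.sub ?_ (Matrix.isHermitian_mul_conjTranspose_self A)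
      simp [Matrix.IsHermitian, Matrix.conjTranspose_smul]
    · have h := conjTranspose_mulVec_norm_sq_le A α
      have e1 : star α ⬝ᵥ (((‖A‖ ^ 2 : ℝ) : ℂ) • (1 : Matrix p p ℂ) -
          A * A.conjTranspose).mulVec α =
          ((‖A‖ ^ 2 * ∑ i, ‖α i‖ ^ 2 - ∑ c, ‖∑ i, star (A i c) * α i‖ ^ 2 : ℝ) : ℂ) := by
        rw [Matrix.sub_mulVec, dotProduct_sub, Matrix.smul_mulVec, Matrix.one_mulVec,
          dotProduct_smul, ← Matrix.mulVec_mulVec, Matrix.dotProduct_mulVec]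
        push_cast
        congr 1
        · simp [dotProduct, ← Complex.conj_mul']
        · simp only [dotProduct, ← Complex.conj_mul']
          refine Finset.sum_congr rfl fun c _ => ?_
          simp [Matrix.vecMul, Matrix.mulVec, dotProduct, mul_comm]
      rw [e1]
      exact_mod_cast sub_nonneg.2 h
  obtain ⟨N, hN⟩ := exists_eq_conjTranspose_mul_self hpos
  refine le_of_sq_le_sq ?_ (by positivity)
  rw [mul_pow, PiLp.norm_sq_eq_of_L2, PiLp.norm_sq_eq_of_L2]
  have h1 := sum_norm_sq_sum_smul A.conjTranspose η.ofLp
  have h2 := sum_norm_sq_sum_smul N η.ofLp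
  rw [← hN] at h2
  rw [Matrix.conjTranspose_conjTranspose] at h1
  have h3 : ((∑ c, ‖∑ i, N c i • η i‖ ^ 2 : ℝ) : ℂ) =
      ((‖A‖ ^ 2 * ∑ i, ‖η i‖ ^ 2 - ∑ c, ‖∑ i, A.conjTranspose c i • η i‖ ^ 2 : ℝ) : ℂ) := by
    rw [h2, Complex.ofReal_sub, h1]
    push_cast
    simp only [Matrix.sub_apply, sub_mul, Finset.sum_sub_distrib, Matrix.smul_apply,
      Matrix.one_apply, smul_eq_mul, mul_ite, mul_one, mul_zero, ite_mul, zero_mul,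
      Finset.sum_ite_eq, Finset.mem_univ, if_true, Finset.mul_sum]
    congr 1
    refine Finset.sum_congr rfl fun i _ => ?_
    rw [inner_self_eq_norm_sq_to_K (𝕜 := ℂ)]
    rfl
  have h4 := Complex.ofReal_injective h3
  have h5 : 0 ≤ ∑ c, ‖∑ i, N c i • η i‖ ^ 2 := by positivity
  have h6 : ∑ c, ‖adjointAct A η c‖ ^ 2 = ∑ c, ‖∑ i, A.conjTranspose c i • η i‖ ^ 2 := rfl
  linarith

theorem opNorm_le_of_norm_inner_le {E : Type*} [NormedAddCommGroup E] [InnerProductSpace ℂ E]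
    (T : E →L[ℂ] E) {C : ℝ} (hC : 0 ≤ C)
    (h : ∀ η ξ : E, ‖inner ℂ η (T ξ)‖ ≤ C * (‖η‖ * ‖ξ‖)) : ‖T‖ ≤ C := by
  refine ContinuousLinearMap.opNorm_le_bound _ hC fun ξ => ?_
  have h1 := h (T ξ) ξ
  rw [inner_self_eq_norm_sq_to_K (𝕜 := ℂ)] at h1
  simp only [Complex.coe_algebraMap, norm_pow, Complex.norm_real, norm_norm] at h1
  rcases (norm_nonneg (T ξ)).eq_or_lt with h0 | h0
  · rw [← h0]; positivity
  · refine le_of_mul_le_mul_left ?_ h0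
    nlinarith

end Norm

/-! ### Every factorization bounds every admissible value -/

section Upper

variable {V : Type u} [AddCommGroup V] [Module ℂ V] [OperatorSpace V]
  {H : Type w} [NormedAddCommGroup H] [InnerProductSpace ℂ H]

theorem sum_norm_sq_adjointAct_blockColumns {p n r : Type*} [Fintype p] [Fintype n] [Fintype r]
    (A : Matrix p (n × r) ℂ) (η : PiLp 2 (fun _ : p => H)) :
    ∑ s, ‖adjointAct (blockColumns A s) η‖ ^ 2 = ‖adjointAct A η‖ ^ 2 := by
  simp only [PiLp.norm_sq_eq_of_L2, Fintype.sum_prod_type]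
  rw [Finset.sum_comm]
  rfl

theorem norm_opMatrix_map_le_of_factorization {k m r : ℕ} {Φ : V →ₗ[ℂ] (H →L[ℂ] H)}
    (hΦ : ampNorm k Φ ≤ 1) (A B : Matrix (Fin m) (Fin k × Fin r) ℂ)
    (x : Fin r → Matrix (Fin k) (Fin k) V) (hx : ∀ s, OperatorSpace.matNorm k (x s) ≤ 1) :
    ‖opMatrix ((sandwich A (Matrix.blockDiagonal x) B).map Φ)‖ ≤ ‖A‖ * ‖B‖ := by
  refine opNorm_le_of_norm_inner_le _ (by positivity) fun η ξ => ?_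
  have e : (sandwich A (Matrix.blockDiagonal x) B).map Φ =
      ∑ s, (sandwich (blockColumns A s) (x s) (blockColumns B s)).map Φ := by
    rw [sandwich_blockDiagonal]
    ext i j : 1
    simp [Matrix.sum_apply]
  rw [e, opMatrix_sum, _root_.sum_apply, inner_sum]
  calc ‖∑ s, inner ℂ η (opMatrix ((sandwich (blockColumns A s) (x s)
          (blockColumns B s)).map Φ) ξ)‖
      ≤ ∑ s, ‖adjointAct (blockColumns A s) η‖ * ‖adjointAct (blockColumns B s) ξ‖ := by
        refine norm_sum_le_of_le _ fun s _ => ?_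
        rw [inner_opMatrix_map_sandwich]
        refine (norm_inner_le_norm _ _).trans ?_
        gcongr
        refine (ContinuousLinearMap.le_opNorm _ _).trans ?_
        exact mul_le_of_le_one_left (norm_nonneg _) (norm_opMatrix_map_le_one hΦ (hx s))
    _ ≤ ‖adjointAct A η‖ * ‖adjointAct B ξ‖ := by
        refine (Real.sum_mul_le_sqrt_mul_sqrt _ _ _).trans_eq ?_
        rw [sum_norm_sq_adjointAct_blockColumns, sum_norm_sq_adjointAct_blockColumns,
          Real.sqrt_sq (norm_nonneg _), Real.sqrt_sq (norm_nonneg _)]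
    _ ≤ (‖A‖ * ‖η‖) * (‖B‖ * ‖ξ‖) := by
        gcongr <;> exact norm_adjointAct_le _ _
    _ = ‖A‖ * ‖B‖ * (‖η‖ * ‖ξ‖) := by ring

theorem le_of_mem_kMaxValues_of_mem_factorizationValues {k m : ℕ}
    {X : Matrix (Fin m) (Fin m) V} {c d : ℝ} (hc : c ∈ kMaxValues.{u, w} k X)
    (hd : d ∈ factorizationValues k X) : c ≤ d := by
  obtain ⟨H, _, _, _, Φ, hΦ, rfl⟩ := hc
  obtain ⟨r, _, A, B, x, hx, rfl, rfl⟩ := hd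
  exact norm_opMatrix_map_le_of_factorization hΦ A B x hx

/-- Makes the set of values nonempty, and hence its supremum nonnegative. -/
theorem zero_mem_kMaxValues (k : ℕ) {m : ℕ} (X : Matrix (Fin m) (Fin m) V) :
    0 ∈ kMaxValues.{u, w} k X := by
  have key : ∀ {n : ℕ} (Y : Matrix (Fin n) (Fin n) V),
      opMatrix (Y.map (0 : V →ₗ[ℂ] (EuclideanSpace ℂ PUnit.{w + 1} →L[ℂ]
        EuclideanSpace ℂ PUnit.{w + 1}))) = 0 := by
    intro n Y
    ext x i
    simp [opMatrix_apply]
  refine ⟨EuclideanSpace ℂ PUnit.{w + 1}, inferInstance, inferInstance, inferInstance, 0, ?_, ?_⟩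
  · simp [ampNorm, key]
  · simp [key]

end Upper

end

noncomputable section

/-! ### Quadratic forms and sandwich algebra -/

section Forms

variable {p n : Type*} [Fintype p] [Fintype n]

/-- The real part of the sesquilinear form `α* P α`. -/
def reForm (P : Matrix p p ℂ) (α : p → ℂ) : ℝ := (star α ⬝ᵥ P.mulVec α).re

/-- The quadratic form of `a a*`, that is, `‖a* α‖²`. -/
def adjointNormSq (a : Matrix p n ℂ) (α : p → ℂ) : ℝ := ∑ c, ‖∑ i, star (a i c) * α i‖ ^ 2

theorem reForm_add (P Q : Matrix p p ℂ) (α : p → ℂ) :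
    reForm (P + Q) α = reForm P α + reForm Q α := by
  simp [reForm, Matrix.add_mulVec]

theorem reForm_smul (t : ℝ) (P : Matrix p p ℂ) (α : p → ℂ) :
    reForm (t • P) α = t * reForm P α := by
  simp [reForm, Matrix.smul_mulVec]

theorem reForm_zero (α : p → ℂ) : reForm (0 : Matrix p p ℂ) α = 0 := by
  simp [reForm]

theorem reForm_one [DecidableEq p] (α : p → ℂ) :
    reForm (1 : Matrix p p ℂ) α = ∑ i, ‖α i‖ ^ 2 := by
  have : star α ⬝ᵥ α = ((∑ i, ‖α i‖ ^ 2 : ℝ) : ℂ) := by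
    push_cast
    simp [dotProduct, ← Complex.conj_mul']
  rw [reForm, Matrix.one_mulVec, this, Complex.ofReal_re]

theorem adjointNormSq_nonneg (a : Matrix p n ℂ) (α : p → ℂ) : 0 ≤ adjointNormSq a α := by
  unfold adjointNormSq; positivity

theorem adjointNormSq_zero (α : p → ℂ) : adjointNormSq (0 : Matrix p n ℂ) α = 0 := by
  simp [adjointNormSq]

theorem adjointNormSq_smul (t : ℂ) (a : Matrix p n ℂ) (α : p → ℂ) :
    adjointNormSq (t • a) α = ‖t‖ ^ 2 * adjointNormSq a α := by
  simp only [adjointNormSq, Finset.mul_sum, ← mul_pow, ← norm_star t, ← norm_mul]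
  simp [mul_assoc]

theorem reForm_mul_conjTranspose (a : Matrix p n ℂ) (α : p → ℂ) :
    reForm (a * a.conjTranspose) α = adjointNormSq a α := by
  have : star α ⬝ᵥ (a * a.conjTranspose).mulVec α = ((adjointNormSq a α : ℝ) : ℂ) := by
    rw [← Matrix.mulVec_mulVec, Matrix.dotProduct_mulVec, adjointNormSq]
    push_cast
    simp only [dotProduct, ← Complex.conj_mul']
    refine Finset.sum_congr rfl fun c _ => ?_
    simp [Matrix.vecMul, Matrix.mulVec, dotProduct, mul_comm]
  rw [reForm, this, Complex.ofReal_re]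

theorem reForm_le_norm [DecidableEq p] (P : Matrix p p ℂ) (α : p → ℂ) :
    |reForm P α| ≤ ‖P‖ * ∑ i, ‖α i‖ ^ 2 := by
  have e : star α ⬝ᵥ P.mulVec α =
      inner ℂ (WithLp.toLp 2 α) ((EuclideanSpace.equiv p ℂ).symm (P.mulVec α)) := by
    simp [PiLp.inner_apply, dotProduct, mul_comm]
  have h := Matrix.l2_opNorm_mulVec P (WithLp.toLp 2 α)
  have h2 : ∑ i, ‖α i‖ ^ 2 = ‖(WithLp.toLp 2 α : EuclideanSpace ℂ p)‖ ^ 2 :=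
    (EuclideanSpace.norm_sq_eq (WithLp.toLp 2 α : EuclideanSpace ℂ p)).symm
  rw [h2, reForm, e]
  refine (Complex.abs_re_le_norm _).trans ((norm_inner_le_norm _ _).trans ?_)
  nlinarith [norm_nonneg (WithLp.toLp 2 α : EuclideanSpace ℂ p)]

end Forms

section Sandwich

variable {V : Type u} [AddCommGroup V] [Module ℂ V] {p n : Type*} [Fintype n]

theorem sandwich_smul_smul (s t : ℂ) (a b : Matrix p n ℂ) (x : Matrix n n V) :
    sandwich (s • a) x (t • b) = (s * star t) • sandwich a x b := by
  ext i j
  simp only [sandwich, Matrix.smul_apply, Matrix.of_apply, Finset.smul_sum, smul_smul,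
    smul_eq_mul, star_mul']
  refine Finset.sum_congr rfl fun c _ => Finset.sum_congr rfl fun d _ => ?_
  congr 1
  ring

theorem sandwich_zero_left (b : Matrix p n ℂ) (x : Matrix n n V) :
    sandwich (0 : Matrix p n ℂ) x b = 0 := by
  ext i j
  simp [sandwich]

theorem sandwich_single [DecidableEq p] [DecidableEq n] (i j : p) (c d : n) (s t : ℂ) (v : V) :
    sandwich (Matrix.single i c s) (Matrix.single c d v) (Matrix.single j d t) =
      Matrix.single i j ((s * star t) • v) := by
  ext i' j'
  simp only [sandwich, Matrix.of_apply, Matrix.single_apply]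
  rw [Finset.sum_eq_single c, Finset.sum_eq_single d]
  · by_cases h1 : i = i' <;> by_cases h2 : j = j' <;> simp [h1, h2]
  · intro d' _ hd'
    simp [hd'.symm]
  · simp
  · intro c' _ hc'
    simp [hc'.symm]
  · simp

end Sandwich

/-! ### The cone of factorizations -/

section Cone

variable (V : Type u) [AddCommGroup V] [Module ℂ V] [OperatorSpace V]

/-- The triples `(P, Q, Y)` such that `Y = ∑ a_s x_s b_s*` with `x_s` in the unit ball of `M_k(V)`,
`∑ a_s a_s* ≤ P` and `∑ b_s b_s* ≤ Q`. -/
def factorizationCone (k m : ℕ) : PointedCone ℝ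
    (Matrix (Fin m) (Fin m) ℂ × Matrix (Fin m) (Fin m) ℂ × Matrix (Fin m) (Fin m) V) where
  carrier := {T | ∃ (r : ℕ) (_ : 1 ≤ r) (a b : Fin r → Matrix (Fin m) (Fin k) ℂ)
    (x : Fin r → Matrix (Fin k) (Fin k) V), (∀ s, OperatorSpace.matNorm k (x s) ≤ 1) ∧
    T.2.2 = ∑ s, sandwich (a s) (x s) (b s) ∧
    (∀ α, ∑ s, adjointNormSq (a s) α ≤ reForm T.1 α) ∧
    (∀ α, ∑ s, adjointNormSq (b s) α ≤ reForm T.2.1 α)}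
  add_mem' := by
    rintro ⟨P, Q, Y⟩ ⟨P', Q', Y'⟩ ⟨r, hr, a, b, x, hx, hY, ha, hb⟩
      ⟨r', hr', a', b', x', hx', hY', ha', hb'⟩
    -- Concatenating the families adds the sandwiches and the forms, so no separate triangle
    -- inequality for the infimum is needed.
    refine ⟨r + r', by omega, Fin.append a a', Fin.append b b', Fin.append x x', ?_, ?_, ?_, ?_⟩
    · intro s
      refine Fin.addCases (fun s => ?_) (fun s => ?_) s
      · simpa using hx s
      · simpa using hx' s
    · simp only at hY hY'
      simp [Fin.sum_univ_add, hY, hY']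
    · intro α
      simpa [Fin.sum_univ_add, reForm_add] using add_le_add (ha α) (ha' α)
    · intro α
      simpa [Fin.sum_univ_add, reForm_add] using add_le_add (hb α) (hb' α)
  zero_mem' := by
    refine ⟨1, le_rfl, 0, 0, 0, fun s => ?_, ?_, ?_, ?_⟩
    · rw [Pi.zero_apply, (OperatorSpace.matNorm_eq_zero_iff k 0).2 rfl]
      exact zero_le_one
    · simp [sandwich_zero_left]
    · simp [adjointNormSq_zero, reForm_zero]
    · simp [adjointNormSq_zero, reForm_zero]
  smul_mem' := by
    rintro ⟨t, ht⟩ ⟨P, Q, Y⟩ ⟨r, hr, a, b, x, hx, hY, ha, hb⟩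
    have e : ‖((√t : ℝ) : ℂ)‖ ^ 2 = t := by
      rw [Complex.norm_real, Real.norm_eq_abs, sq_abs, Real.sq_sqrt ht]
    -- One factor √t on each side scales Y, P and Q alike by t.
    refine ⟨r, hr, fun s => ((√t : ℝ) : ℂ) • a s, fun s => ((√t : ℝ) : ℂ) • b s, x, hx, ?_, ?_, ?_⟩
    · simp only at hY
      simp only [sandwich_smul_smul, ← Finset.smul_sum, ← hY]
      have : ((√t : ℝ) : ℂ) * star ((√t : ℝ) : ℂ) = (t : ℂ) := by
        rw [Complex.star_def, Complex.conj_ofReal, ← Complex.ofReal_mul, Real.mul_self_sqrt ht]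
      rw [this]
      rfl
    · intro α
      have := mul_le_mul_of_nonneg_left (ha α) ht
      simp only [adjointNormSq_smul, e, ← Finset.mul_sum]
      exact this.trans_eq (reForm_smul t P α).symm
    · intro α
      have := mul_le_mul_of_nonneg_left (hb α) ht
      simp only [adjointNormSq_smul, e, ← Finset.mul_sum]
      exact this.trans_eq (reForm_smul t Q α).symm

variable {V}

theorem mem_factorizationCone {k m : ℕ} {P Q : Matrix (Fin m) (Fin m) ℂ}
    {Y : Matrix (Fin m) (Fin m) V} :
    (P, Q, Y) ∈ factorizationCone V k m ↔
    ∃ (r : ℕ) (_ : 1 ≤ r) (a b : Fin r → Matrix (Fin m) (Fin k) ℂ)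
    (x : Fin r → Matrix (Fin k) (Fin k) V), (∀ s, OperatorSpace.matNorm k (x s) ≤ 1) ∧
    Y = ∑ s, sandwich (a s) (x s) (b s) ∧
    (∀ α, ∑ s, adjointNormSq (a s) α ≤ reForm P α) ∧
    (∀ α, ∑ s, adjointNormSq (b s) α ≤ reForm Q α) := Iff.rfl

theorem factorizationCone_mono {k m : ℕ} {P Q P' Q' : Matrix (Fin m) (Fin m) ℂ}
    {Y : Matrix (Fin m) (Fin m) V} (h : (P, Q, Y) ∈ factorizationCone V k m)
    (hP : ∀ α, reForm P α ≤ reForm P' α) (hQ : ∀ α, reForm Q α ≤ reForm Q' α) :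
    (P', Q', Y) ∈ factorizationCone V k m := by
  obtain ⟨r, hr, a, b, x, hx, hY, ha, hb⟩ := mem_factorizationCone.1 h
  exact mem_factorizationCone.2 ⟨r, hr, a, b, x, hx, hY, fun α => (ha α).trans (hP α),
    fun α => (hb α).trans (hQ α)⟩

theorem mk_mem_factorizationCone {k m : ℕ} (a b : Matrix (Fin m) (Fin k) ℂ)
    {x : Matrix (Fin k) (Fin k) V} (hx : OperatorSpace.matNorm k x ≤ 1) :
    (a * a.conjTranspose, b * b.conjTranspose, sandwich a x b) ∈ factorizationCone V k m :=
  mem_factorizationCone.2 ⟨1, le_rfl, fun _ => a, fun _ => b, fun _ => x, fun _ => hx, by simp,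
    fun α => by simp [reForm_mul_conjTranspose], fun α => by simp [reForm_mul_conjTranspose]⟩

/-- By additivity a single matrix unit suffices; it is routed through one diagonal corner of M_k(V),
which exists since k ≥ 1. -/
theorem exists_smul_one_mem_factorizationCone {k : ℕ} (hk : 1 ≤ k) {m : ℕ}
    (Y : Matrix (Fin m) (Fin m) V) :
    ∃ s : ℝ, (s • (1 : Matrix (Fin m) (Fin m) ℂ), s • (1 : Matrix (Fin m) (Fin m) ℂ), Y) ∈
      factorizationCone V k m := by
  induction Y using Matrix.induction_on' with
  | h_zero => exact ⟨0, by simp only [zero_smul]; exact (factorizationCone V k m).zero_mem⟩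
  | h_add Y Z hY hZ =>
    obtain ⟨s, hs⟩ := hY
    obtain ⟨t, ht⟩ := hZ
    refine ⟨s + t, ?_⟩
    simpa [add_smul] using (factorizationCone V k m).add_mem hs ht
  | h_std_basis i j v =>
    let c : Fin k := ⟨0, hk⟩
    -- The summand 1 keeps N invertible even if v = 0.
    let N : ℝ := OperatorSpace.matNorm k (Matrix.single c c v) + 1
    have hN : 0 < N := by
      have := OperatorSpace.matNorm_nonneg k (Matrix.single c c v)
      positivity
    have hx : OperatorSpace.matNorm k (Matrix.single c c (((N⁻¹ : ℝ) : ℂ) • v)) ≤ 1 := by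
      rw [← Matrix.smul_single, OperatorSpace.matNorm_smul, Complex.norm_real, Real.norm_eq_abs,
        abs_of_pos (inv_pos.2 hN), inv_mul_le_iff₀ hN]
      simp [N]
    have h := mk_mem_factorizationCone (Matrix.single i c ((N : ℝ) : ℂ)) (Matrix.single j c 1) hx
    have e : (((N : ℝ) : ℂ) * star 1) • (((N⁻¹ : ℝ) : ℂ) • v) = v := by
      rw [smul_smul, star_one, mul_one, ← Complex.ofReal_mul, mul_inv_cancel₀ hN.ne',
        Complex.ofReal_one, one_smul]
    rw [sandwich_single, e] at h
    refine ⟨‖Matrix.single i c ((N : ℝ) : ℂ) * (Matrix.single i c ((N : ℝ) : ℂ)).conjTranspose‖ +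
      ‖Matrix.single j c (1 : ℂ) * (Matrix.single j c (1 : ℂ)).conjTranspose‖,
      factorizationCone_mono h (fun α => ?_) (fun α => ?_)⟩
    all_goals
      rw [reForm_smul, reForm_one]
      refine (le_abs_self _).trans ((reForm_le_norm _ _).trans ?_)
      gcongr
    · exact le_add_of_nonneg_right (norm_nonneg _)
    · exact le_add_of_nonneg_left (norm_nonneg _)

/-- The cofinality condition of the Riesz extension: multiples of (1, 1, 0) move any triple into the
cone. -/
theorem exists_add_smul_one_mem_factorizationCone {k : ℕ} (hk : 1 ≤ k) {m : ℕ}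
    (P Q : Matrix (Fin m) (Fin m) ℂ) (Y : Matrix (Fin m) (Fin m) V) :
    ∃ s : ℝ, (s • (1 : Matrix (Fin m) (Fin m) ℂ) + P, s • (1 : Matrix (Fin m) (Fin m) ℂ) + Q, Y) ∈
      factorizationCone V k m := by
  obtain ⟨s, hs⟩ := exists_smul_one_mem_factorizationCone hk Y
  refine ⟨s + ‖P‖ + ‖Q‖, factorizationCone_mono hs (fun α => ?_) (fun α => ?_)⟩
  all_goals
    have h1 := (neg_le_abs _).trans (reForm_le_norm P α)
    have h2 := (neg_le_abs _).trans (reForm_le_norm Q α)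
    have h3 : 0 ≤ ∑ i, ‖α i‖ ^ 2 := by positivity
    have h4 := mul_nonneg (norm_nonneg P) h3
    have h5 := mul_nonneg (norm_nonneg Q) h3
    rw [reForm_add, reForm_smul, reForm_smul, reForm_one]
    linarith

/-- Placing the a_s side by side gives A with AA* = ∑ a_s a_s* ≤ s², and likewise for B. -/
theorem exists_factorization_of_mem_factorizationCone {k m : ℕ} {s t : ℝ} (hs : 0 ≤ s)
    (ht : 0 ≤ t) {Y : Matrix (Fin m) (Fin m) V}
    (h : ((s ^ 2) • (1 : Matrix (Fin m) (Fin m) ℂ), (t ^ 2) • (1 : Matrix (Fin m) (Fin m) ℂ), Y) ∈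
      factorizationCone V k m) :
    ∃ c ∈ factorizationValues k Y, c ≤ s * t := by
  obtain ⟨r, hr, a, b, x, hx, hY, ha, hb⟩ := mem_factorizationCone.1 h
  let A : Matrix (Fin m) (Fin k × Fin r) ℂ := Matrix.of fun i q => a q.2 i q.1
  let B : Matrix (Fin m) (Fin k × Fin r) ℂ := Matrix.of fun i q => b q.2 i q.1
  have hA : ‖A‖ ≤ s := by
    refine l2_opNorm_le_of_conjTranspose_mulVec A s hs fun α => ?_
    have := ha α
    rw [reForm_smul, reForm_one] at this
    rw [Fintype.sum_prod_type, Finset.sum_comm]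
    exact this
  have hB : ‖B‖ ≤ t := by
    refine l2_opNorm_le_of_conjTranspose_mulVec B t ht fun α => ?_
    have := hb α
    rw [reForm_smul, reForm_one] at this
    rw [Fintype.sum_prod_type, Finset.sum_comm]
    exact this
  refine ⟨‖A‖ * ‖B‖, ⟨r, hr, A, B, x, hx, ?_, rfl⟩, by gcongr⟩
  rw [sandwich_blockDiagonal, hY]
  rfl

theorem factorizationValues_nonneg {k m : ℕ} {Y : Matrix (Fin m) (Fin m) V} {c : ℝ}
    (hc : c ∈ factorizationValues k Y) : 0 ≤ c := by
  obtain ⟨r, hr, A, B, x, hx, -, rfl⟩ := hc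
  positivity

theorem bddBelow_factorizationValues (k : ℕ) {m : ℕ} (Y : Matrix (Fin m) (Fin m) V) :
    BddBelow (factorizationValues k Y) := ⟨0, fun _ => factorizationValues_nonneg⟩

theorem factorizationValues_nonempty {k : ℕ} (hk : 1 ≤ k) {m : ℕ} (Y : Matrix (Fin m) (Fin m) V) :
    (factorizationValues k Y).Nonempty := by
  obtain ⟨s, hs⟩ := exists_smul_one_mem_factorizationCone hk Y
  -- The sign of s is not known, hence the truncation at 0 before taking the root.
  have hm : ∀ α : Fin m → ℂ, reForm (s • (1 : Matrix (Fin m) (Fin m) ℂ)) α ≤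
      reForm ((√(max s 0) ^ 2) • (1 : Matrix (Fin m) (Fin m) ℂ)) α := fun α => by
    rw [reForm_smul, reForm_smul, reForm_one, Real.sq_sqrt (le_max_right _ _)]
    gcongr
    exact le_max_left _ _
  obtain ⟨c, hc, -⟩ := exists_factorization_of_mem_factorizationCone (Real.sqrt_nonneg _)
    (Real.sqrt_nonneg _) (factorizationCone_mono hs hm hm)
  exact ⟨c, hc⟩

end Cone

end

noncomputable section

/-! ### Hahn–Banach separation -/

section Separation

variable {V : Type u} [AddCommGroup V] [Module ℂ V] [OperatorSpace V]

/-- Positivity of the functional to be extended, on the plane spanned by (1, 1, 0) and (0, 0, X).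
For z > 0, dividing by z gives a factorization of X of value at most s/z. -/
theorem mul_sInf_factorizationValues_le {k m : ℕ} {X : Matrix (Fin m) (Fin m) V} (hX : X ≠ 0)
    {s z : ℝ} (h : (s • (1 : Matrix (Fin m) (Fin m) ℂ), s • (1 : Matrix (Fin m) (Fin m) ℂ), z • X) ∈
      factorizationCone V k m) : z * sInf (factorizationValues k X) ≤ s := by
  have hs : 0 ≤ s := by
    obtain ⟨r, hr, a, b, x, hx, hY, ha, hb⟩ := mem_factorizationCone.1 h
    have : Nonempty (Fin m) := by
      by_contra hm
      rw [not_nonempty_iff] at hm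
      exact hX (Subsingleton.elim _ _)
    have h1 := ha (fun _ => 1)
    rw [reForm_smul, reForm_one] at h1
    have h2 : 0 ≤ ∑ s, adjointNormSq (a s) (fun _ => 1) :=
      Finset.sum_nonneg fun s _ => adjointNormSq_nonneg _ _
    have h3 : 0 < ∑ i : Fin m, ‖(1 : ℂ)‖ ^ 2 := by
      simpa [← Fin.pos_iff_nonempty] using this
    exact nonneg_of_mul_nonneg_left (h2.trans h1) h3
  have h0 : 0 ≤ sInf (factorizationValues k X) :=
    Real.sInf_nonneg fun _ => factorizationValues_nonneg
  rcases le_or_gt z 0 with hz | hz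
  · exact (mul_nonpos_of_nonpos_of_nonneg hz h0).trans hs
  have h1 := (factorizationCone V k m).smul_mem (inv_pos.2 hz).le h
  have e : √(z⁻¹ * s) ^ 2 = z⁻¹ * s := Real.sq_sqrt (by positivity)
  have h2 : ((√(z⁻¹ * s) ^ 2) • (1 : Matrix (Fin m) (Fin m) ℂ),
      (√(z⁻¹ * s) ^ 2) • (1 : Matrix (Fin m) (Fin m) ℂ), X) ∈ factorizationCone V k m := by
    rw [e]
    have e2 : X = z⁻¹ • z • X := by rw [smul_smul, inv_mul_cancel₀ hz.ne', one_smul]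
    rw [mul_smul, e2]
    simpa [smul_smul, hz.ne'] using h1
  obtain ⟨c, hc, hcs⟩ := exists_factorization_of_mem_factorizationCone (Real.sqrt_nonneg _)
    (Real.sqrt_nonneg _) h2
  have h3 := (csInf_le (bddBelow_factorizationValues k X) hc).trans hcs
  rw [← sq, e] at h3
  rwa [le_inv_mul_iff₀ hz] at h3

/-- Hahn–Banach separation for the norm defined by factorizations. -/
theorem exists_functional_dominated {k : ℕ} (hk : 1 ≤ k) {m : ℕ} {X : Matrix (Fin m) (Fin m) V}
    (hX : X ≠ 0) :
    ∃ (p q : Matrix (Fin m) (Fin m) ℂ →ₗ[ℝ] ℝ) (h : Matrix (Fin m) (Fin m) V →ₗ[ℝ] ℝ),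
      (∀ P Q Y, (P, Q, Y) ∈ factorizationCone V k m → 2 * h Y ≤ p P + q Q) ∧
      p 1 + q 1 = 2 ∧ h X = sInf (factorizationValues k X) := by
  let E := Matrix (Fin m) (Fin m) ℂ × Matrix (Fin m) (Fin m) ℂ × Matrix (Fin m) (Fin m) V
  let L : ℝ × ℝ →ₗ[ℝ] E := (LinearMap.fst ℝ ℝ ℝ).smulRight ((1, 1, 0) : E) +
    (LinearMap.snd ℝ ℝ ℝ).smulRight ((0, 0, X) : E)
  have hL : ∀ s z : ℝ, L (s, z) = (s • 1, s • 1, z • X) := fun s z => by simp [L]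
  have hinj : Function.Injective L := by
    rw [injective_iff_map_eq_zero]
    rintro ⟨s, z⟩ hsz
    rw [hL, Prod.mk_eq_zero, Prod.mk_eq_zero] at hsz
    have : Nonempty (Fin m) := by
      by_contra hm
      rw [not_nonempty_iff] at hm
      exact hX (Subsingleton.elim _ _)
    have h1 := (smul_eq_zero.1 hsz.1).resolve_right one_ne_zero
    have h2 := (smul_eq_zero.1 hsz.2.2).resolve_right hX
    rw [h1, h2]; rfl
  -- The factor 2 matches the two unit entries of (1, 1, 0) and the inequality 2‖η‖‖ξ‖ ≤ ‖η‖² + ‖ξ‖²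
  -- used later.
  let φ : ℝ × ℝ →ₗ[ℝ] ℝ := (2 : ℝ) • LinearMap.fst ℝ ℝ ℝ -
    (2 * sInf (factorizationValues k X)) • LinearMap.snd ℝ ℝ ℝ
  let F : E →ₗ.[ℝ] ℝ := ⟨LinearMap.range L, φ ∘ₗ (LinearEquiv.ofInjective L hinj).symm.toLinearMap⟩
  have hF : ∀ (s z : ℝ) (hm : L (s, z) ∈ F.domain),
      F ⟨L (s, z), hm⟩ = 2 * s - 2 * sInf (factorizationValues k X) * z := by
    intro s z hm
    have : (LinearEquiv.ofInjective L hinj).symm ⟨L (s, z), hm⟩ = (s, z) := by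
      rw [LinearEquiv.symm_apply_eq]; rfl
    change φ ((LinearEquiv.ofInjective L hinj).symm ⟨L (s, z), hm⟩) = _
    rw [this]
    simp [φ]
  obtain ⟨g, hg, hpos⟩ := riesz_extension (factorizationCone V k m) F
    (by
      rintro ⟨_, ⟨⟨s, z⟩, rfl⟩⟩ hmem
      refine le_of_le_of_eq ?_ (hF s z ⟨_, rfl⟩).symm
      simp only [hL] at hmem
      have := mul_sInf_factorizationValues_le hX hmem
      linarith)
    (by
      rintro ⟨P, Q, Y⟩
      obtain ⟨s, hs⟩ := exists_add_smul_one_mem_factorizationCone hk P Q Y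
      refine ⟨⟨L (s, 0), ⟨_, rfl⟩⟩, ?_⟩
      simpa [hL] using hs)
  have hg' : ∀ s z : ℝ, g (s • 1, s • 1, z • X) =
      2 * s - 2 * sInf (factorizationValues k X) * z := fun s z => by
    rw [← hL, ← hF s z ⟨_, rfl⟩, ← hg]
  -- The negative sign on the third component turns g ≥ 0 on the cone into domination of h.
  refine ⟨g ∘ₗ LinearMap.inl ℝ _ _, g ∘ₗ LinearMap.inr ℝ _ _ ∘ₗ LinearMap.inl ℝ _ _,
    (-(1 / 2) : ℝ) • g ∘ₗ LinearMap.inr ℝ _ _ ∘ₗ LinearMap.inr ℝ _ _, ?_, ?_, ?_⟩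
  · intro P Q Y hm
    have h1 := hpos _ hm
    have e : ((P, Q, Y) : E) = (P, 0) + ((0, (Q, 0)) + (0, (0, Y))) := by simp
    rw [e, map_add, map_add] at h1
    simp only [LinearMap.comp_apply, LinearMap.inl_apply, LinearMap.inr_apply,
      LinearMap.smul_apply, smul_eq_mul]
    linarith
  · have h1 := hg' 1 0
    simp only [LinearMap.comp_apply, LinearMap.inl_apply, LinearMap.inr_apply]
    rw [← map_add]
    simpa using h1
  · have h1 := hg' 0 1
    simp only [LinearMap.comp_apply, LinearMap.inr_apply, LinearMap.smul_apply, smul_eq_mul]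
    rw [zero_smul, one_smul] at h1
    have h2 : g (0, 0, X) = 2 * 0 - 2 * sInf (factorizationValues k X) * 1 := h1
    rw [h2]; ring

end Separation

end

noncomputable section

/-! ### Densities of positive functionals -/

section Density

open scoped ComplexOrder

theorem exists_re_trace_eq {n : Type*} [Fintype n] [DecidableEq n] (p : Matrix n n ℂ →ₗ[ℝ] ℝ) :
    ∃ R : Matrix n n ℂ, ∀ M, p M = (R * M).trace.re := by
  refine ⟨Matrix.of fun j i => ((p (Matrix.single i j 1) : ℝ) : ℂ) -
    Complex.I * ((p (Matrix.single i j Complex.I) : ℝ) : ℂ), fun M => ?_⟩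
  have key : ∀ i j (z : ℂ), p (Matrix.single i j z) =
      ((((p (Matrix.single i j 1) : ℝ) : ℂ) -
        Complex.I * ((p (Matrix.single i j Complex.I) : ℝ) : ℂ)) * z).re := by
    intro i j z
    have e : Matrix.single i j z = z.re • Matrix.single i j (1 : ℂ) +
        z.im • Matrix.single i j Complex.I := by
      rw [Matrix.smul_single, Matrix.smul_single, ← Matrix.single_add]
      congr 1
      simp
    rw [e, map_add, map_smul, map_smul]
    simp
    ring
  conv_lhs => rw [Matrix.matrix_eq_sum_single M]
  simp only [map_sum, Matrix.trace, Matrix.diag_apply, Matrix.mul_apply, Complex.re_sum,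
    Matrix.of_apply]
  rw [Finset.sum_comm]
  exact Finset.sum_congr rfl fun j _ => Finset.sum_congr rfl fun i _ => key i j (M i j)

/-- The square of the Hilbert–Schmidt norm. -/
def frobeniusSq {p n : Type*} [Fintype p] [Fintype n] (a : Matrix p n ℂ) : ℝ :=
  ∑ i, ∑ c, ‖a i c‖ ^ 2

theorem re_trace_mul_conjTranspose {p n : Type*} [Fintype p] [Fintype n] (a : Matrix p n ℂ) :
    (a * a.conjTranspose).trace.re = frobeniusSq a := by
  simp [Matrix.trace, Matrix.mul_apply, frobeniusSq, Complex.mul_conj', ← Complex.ofReal_pow]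

theorem frobeniusSq_one {p : Type*} [Fintype p] [DecidableEq p] :
    frobeniusSq (1 : Matrix p p ℂ) = Fintype.card p := by
  rw [← re_trace_mul_conjTranspose]
  simp

/-- Only Hermitian arguments matter, so the density of p may be replaced by its Hermitian part.
Testing on rank one matrices αα* shows it is positive semidefinite; adding ε makes it positive
definite, so its factor S is invertible. -/
theorem exists_isUnit_frobeniusSq_mul_eq {n : Type*} [Fintype n] [DecidableEq n]
    (p : Matrix n n ℂ →ₗ[ℝ] ℝ) (hp : ∀ P, (∀ α, 0 ≤ reForm P α) → 0 ≤ p P)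
    {ε : ℝ} (hε : 0 < ε) :
    ∃ S : Matrix n n ℂ, IsUnit S ∧ ∀ {k : ℕ} (a : Matrix n (Fin k) ℂ),
      frobeniusSq (S * a) = p (a * a.conjTranspose) + ε * frobeniusSq a := by
  obtain ⟨R, hR⟩ := exists_re_trace_eq p
  let R' : Matrix n n ℂ := (1 / 2 : ℂ) • (R + R.conjTranspose)
  have hR' : ∀ M : Matrix n n ℂ, M.IsHermitian → p M = (R' * M).trace.re := by
    intro M hM
    have h1 : (R.conjTranspose * M).trace = star (R * M).trace := by
      rw [← Matrix.trace_conjTranspose, Matrix.conjTranspose_mul, hM.eq, Matrix.trace_mul_comm]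
    have h2 : (1 / 2 : ℂ) * ((R * M).trace + star (R * M).trace) = (((R * M).trace.re : ℝ) : ℂ) := by
      rw [Complex.star_def, Complex.add_conj]
      push_cast
      ring
    rw [hR, Matrix.smul_mul, Matrix.trace_smul, Matrix.add_mul, Matrix.trace_add, h1, smul_eq_mul,
      h2, Complex.ofReal_re]
  have hherm : R'.IsHermitian := by
    simp [R', Matrix.IsHermitian, Matrix.conjTranspose_smul, add_comm]
  have hpos : R'.PosSemidef := by
    refine Matrix.PosSemidef.of_dotProduct_mulVec_nonneg hherm fun α => ?_
    have e : Matrix.vecMulVec α (star α) =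
        Matrix.replicateCol Unit α * (Matrix.replicateCol Unit α).conjTranspose := by
      rw [Matrix.conjTranspose_replicateCol, ← Matrix.vecMulVec_eq]
    have h1 : (Matrix.vecMulVec α (star α)).IsHermitian := by
      rw [e]; exact Matrix.isHermitian_mul_conjTranspose_self _
    have h2 := hp (Matrix.vecMulVec α (star α)) fun β => by
      rw [e, reForm_mul_conjTranspose]; exact adjointNormSq_nonneg _ _
    rw [hR' _ h1, Matrix.mul_vecMulVec, Matrix.trace_vecMulVec, dotProduct_comm] at h2
    rw [Complex.nonneg_iff]
    exact ⟨h2, (hherm.im_star_dotProduct_mulVec_self α).symm⟩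
  have hdef : (R' + (ε : ℂ) • (1 : Matrix n n ℂ)).PosDef := by
    rw [add_comm]
    refine Matrix.PosDef.add_posSemidef (Matrix.PosDef.one.smul ?_) hpos
    exact_mod_cast hε
  obtain ⟨S, hS⟩ := exists_eq_conjTranspose_mul_self hdef.posSemidef
  refine ⟨S, ?_, fun {k} a => ?_⟩
  · have h1 := hdef.isUnit
    rw [hS, Matrix.isUnit_iff_isUnit_det, Matrix.det_mul] at h1
    rw [Matrix.isUnit_iff_isUnit_det]
    exact isUnit_of_mul_isUnit_right h1
  · have h1 : (S * a * (S * a).conjTranspose).trace =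
        ((R' + (ε : ℂ) • (1 : Matrix n n ℂ)) * (a * a.conjTranspose)).trace := by
      rw [hS, Matrix.conjTranspose_mul, ← Matrix.mul_assoc, Matrix.trace_mul_comm]
      simp only [Matrix.mul_assoc]
    rw [← re_trace_mul_conjTranspose, h1, Matrix.add_mul, Matrix.trace_add, Complex.add_re,
      ← hR' _ (Matrix.isHermitian_mul_conjTranspose_self a), Matrix.smul_mul, Matrix.one_mul,
      Matrix.trace_smul, smul_eq_mul, Complex.re_ofReal_mul, re_trace_mul_conjTranspose]

end Density

/-! ### From a dominated functional to a representation -/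

section Representation

variable {V : Type u} [AddCommGroup V] [Module ℂ V] [OperatorSpace V]

/-- Take η = Tξ and absorb one ‖Tξ‖². -/
theorem opNorm_le_one_of_re_inner_le {E : Type*} [NormedAddCommGroup E] [InnerProductSpace ℂ E]
    (T : E →L[ℂ] E) (h : ∀ η ξ : E, 2 * (inner ℂ η (T ξ)).re ≤ ‖η‖ ^ 2 + ‖ξ‖ ^ 2) : ‖T‖ ≤ 1 := by
  refine ContinuousLinearMap.opNorm_le_bound _ zero_le_one fun ξ => ?_
  have h1 := h (T ξ) ξ
  have h2 : (inner ℂ (T ξ) (T ξ)).re = ‖T ξ‖ ^ 2 := (norm_sq_eq_re_inner (𝕜 := ℂ) (T ξ)).symm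
  rw [h2] at h1
  rw [one_mul]
  exact le_of_sq_le_sq (by linarith) (norm_nonneg _)

/-- The vector in the Hilbert space sum of copies of `ℂ^ι` whose entries are the conjugated columns
of a matrix. -/
def conjColumns {ι n : Type*} [Fintype ι] (S : Matrix ι n ℂ) :
    PiLp 2 (fun _ : n => EuclideanSpace ℂ ι) :=
  WithLp.toLp 2 fun i => WithLp.toLp 2 fun l => star (S l i)

theorem norm_sq_conjColumns {ι n : Type*} [Fintype ι] [Fintype n] (S : Matrix ι n ℂ) :
    ‖conjColumns S‖ ^ 2 = frobeniusSq S := by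
  rw [PiLp.norm_sq_eq_of_L2, frobeniusSq, Finset.sum_comm]
  refine Finset.sum_congr rfl fun i _ => ?_
  rw [EuclideanSpace.norm_sq_eq]
  simp [conjColumns]

/-- This is what the conjugation in `conjColumns` is for: A* acts as right multiplication, so for
invertible S every vector arises from `conjColumns S`. -/
theorem adjointAct_conjColumns {ι p n : Type*} [Fintype ι] [Fintype p] [Fintype n]
    (S : Matrix ι p ℂ) (a : Matrix p n ℂ) :
    adjointAct a (conjColumns S) = conjColumns (S * a) := by
  ext c l
  simp [conjColumns, Matrix.mul_apply, mul_comm]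

theorem exists_conjColumns_eq {ι n : Type*} [Fintype ι]
    (ω : PiLp 2 (fun _ : n => EuclideanSpace ℂ ι)) :
    ∃ A : Matrix ι n ℂ, conjColumns A = ω :=
  ⟨Matrix.of fun l c => star (ω c l), by ext c l; simp [conjColumns]⟩

/-- A functional dominated by Hilbert–Schmidt norms is a vector functional of a representation
whose `k`-th amplification is contractive. -/
theorem exists_representation_of_dominated {k m : ℕ} {ι : Type w} [Fintype ι] [DecidableEq ι]
    (h : Matrix (Fin m) (Fin m) V →ₗ[ℝ] ℝ) {S T : Matrix ι (Fin m) ℂ}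
    {S' T' : Matrix (Fin m) ι ℂ} (hS : S * S' = 1) (hS' : S' * S = 1) (hT : T * T' = 1)
    (hT' : T' * T = 1)
    (hdom : ∀ (a b : Matrix (Fin m) (Fin k) ℂ) (x : Matrix (Fin k) (Fin k) V),
      OperatorSpace.matNorm k x ≤ 1 →
      2 * h (sandwich a x b) ≤ frobeniusSq (S * a) + frobeniusSq (T * b)) :
    ∃ Φ : V →ₗ[ℂ] (EuclideanSpace ℂ ι →L[ℂ] EuclideanSpace ℂ ι), ampNorm k Φ ≤ 1 ∧
      ∀ Y, h Y = (inner ℂ (conjColumns S) (opMatrix (Y.map Φ) (conjColumns T))).re := by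
  let f : Matrix (Fin m) (Fin m) V →ₗ[ℂ] ℂ := Module.Dual.extendRCLike h
  have hf : ∀ Y, (f Y).re = h Y := fun Y => Module.Dual.re_extendRCLike_apply (𝕜 := ℂ) h Y
  let F : V → Matrix (Fin m) (Fin m) ℂ := fun v => Matrix.of fun i j => f (Matrix.single i j v)
  -- G is the solution of Sᵀ G(v) T̄ = F(v), which makes f the vector functional of Φ at the columns
  -- of S and T.
  let G : V →ₗ[ℂ] Matrix ι ι ℂ :=
    { toFun := fun v => S'.transpose * F v * T'.map star
      map_add' := fun v v' => by
        have : F (v + v') = F v + F v' := by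
          ext i j; simp [F, Matrix.single_add]
        rw [this, Matrix.mul_add, Matrix.add_mul]
      map_smul' := fun c v => by
        have : F (c • v) = c • F v := by
          ext i j
          simp only [F, Matrix.of_apply, ← Matrix.smul_single, map_smul, Matrix.smul_apply]
        rw [this, Matrix.mul_smul, Matrix.smul_mul, RingHom.id_apply] }
  have hG : ∀ v, S.transpose * G v * T.map star = F v := by
    intro v
    have h1 : S.transpose * S'.transpose = 1 := by
      rw [← Matrix.transpose_mul, hS', Matrix.transpose_one]
    have h2 : T'.map star * T.map star = 1 := by
      have := congrArg (fun M : Matrix (Fin m) (Fin m) ℂ => M.map (starRingEnd ℂ)) hT'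
      simp only [Matrix.map_mul] at this
      simpa using this
    calc S.transpose * (S'.transpose * F v * T'.map star) * T.map star
        = (S.transpose * S'.transpose) * F v * (T'.map star * T.map star) := by
          simp only [Matrix.mul_assoc]
      _ = F v := by rw [h1, h2, Matrix.one_mul, Matrix.mul_one]
  let Φ : V →ₗ[ℂ] (EuclideanSpace ℂ ι →L[ℂ] EuclideanSpace ℂ ι) :=
    (Matrix.toEuclideanCLM (𝕜 := ℂ) (n := ι)).toAlgEquiv.toLinearMap ∘ₗ G
  have hΦ : ∀ Y, f Y = inner ℂ (conjColumns S) (opMatrix (Y.map Φ) (conjColumns T)) := by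
    intro Y
    rw [inner_opMatrix]
    conv_lhs => rw [Matrix.matrix_eq_sum_single Y]
    simp only [map_sum]
    refine Finset.sum_congr rfl fun i _ => Finset.sum_congr rfl fun j _ => ?_
    have h1 : f (Matrix.single i j (Y i j)) = F (Y i j) i j := rfl
    rw [h1, ← hG, Matrix.mul_assoc, Matrix.mul_apply, PiLp.inner_apply]
    refine Finset.sum_congr rfl fun l _ => ?_
    have h2 : (Φ (Y i j) (conjColumns T j)).ofLp = (G (Y i j)).mulVec (conjColumns T j).ofLp :=
      Matrix.ofLp_toEuclideanCLM _ _
    rw [Matrix.map_apply, h2]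
    simp [conjColumns, Matrix.mul_apply, Matrix.mulVec, dotProduct, mul_comm]
  refine ⟨Φ, ?_, fun Y => by rw [← hΦ, hf]⟩
  refine iSup₂_le fun x hx => ?_
  rw [ENNReal.ofReal_le_one]
  refine opNorm_le_one_of_re_inner_le _ fun ω ζ => ?_
  obtain ⟨A, rfl⟩ := exists_conjColumns_eq ω
  obtain ⟨B, rfl⟩ := exists_conjColumns_eq ζ
  -- The arbitrary vectors are A = S(S'A) and B = T(T'B), so the domination bounds the form of Φ(x)
  -- at them.
  have h1 := hdom (S' * A) (T' * B) x hx
  rw [← hf, hΦ, inner_opMatrix_map_sandwich, adjointAct_conjColumns, adjointAct_conjColumns,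
    ← Matrix.mul_assoc, ← Matrix.mul_assoc, hS, hT, Matrix.one_mul, Matrix.one_mul] at h1
  rwa [norm_sq_conjColumns, norm_sq_conjColumns]

end Representation

/-! ### The lower bound and the limit ε → 0 -/

section Main

variable {V : Type u} [AddCommGroup V] [Module ℂ V] [OperatorSpace V]

theorem exists_mem_kMaxValues_sInf_le {k : ℕ} (hk : 1 ≤ k) {m : ℕ} {X : Matrix (Fin m) (Fin m) V}
    (hX : X ≠ 0) {ε : ℝ} (hε : 0 < ε) :
    ∃ c ∈ kMaxValues.{u, w} k X, sInf (factorizationValues k X) ≤ c * (1 + ε * m) := by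
  obtain ⟨p, q, h, hdom, hpq, hXh⟩ := exists_functional_dominated hk hX
  -- For P ≥ 0 the triple (P, 0, 0) lies in the cone, by enlarging the first entry of the vertex.
  have hp : ∀ P, (∀ α, 0 ≤ reForm P α) → 0 ≤ p P := fun P hP => by
    have := hdom P 0 0 (factorizationCone_mono (factorizationCone V k m).zero_mem
      (fun α => by simpa [reForm_zero] using hP α) fun _ => le_rfl)
    simpa using this
  have hq : ∀ P, (∀ α, 0 ≤ reForm P α) → 0 ≤ q P := fun P hP => by
    have := hdom 0 P 0 (factorizationCone_mono (factorizationCone V k m).zero_mem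
      (fun _ => le_rfl) fun α => by simpa [reForm_zero] using hP α)
    simpa using this
  obtain ⟨S, hSu, hS⟩ := exists_isUnit_frobeniusSq_mul_eq p hp hε
  obtain ⟨T, hTu, hT⟩ := exists_isUnit_frobeniusSq_mul_eq q hq hε
  rw [Matrix.isUnit_iff_isUnit_det] at hSu hTu
  -- `ULift` puts the Hilbert space in universe `w`; relabelling rows keeps the Hilbert–Schmidt
  -- norm.
  have hfrob : ∀ {n : ℕ} (M : Matrix (Fin m) (Fin m) ℂ) (a : Matrix (Fin m) (Fin n) ℂ),
      frobeniusSq (M.submatrix (Equiv.ulift.{w} : ULift.{w} (Fin m) ≃ Fin m) (Equiv.refl _) * a) =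
        frobeniusSq (M * a) := fun M a =>
    Equiv.sum_comp Equiv.ulift fun i => ∑ c, ‖(M * a) i c‖ ^ 2
  have hnn : ∀ {n : ℕ} (a : Matrix (Fin m) (Fin n) ℂ), 0 ≤ frobeniusSq a := fun a => by
    unfold frobeniusSq; positivity
  obtain ⟨Φ, hΦ, hΦh⟩ := exists_representation_of_dominated (k := k) (ι := ULift.{w} (Fin m)) h
    (S := S.submatrix Equiv.ulift (Equiv.refl _)) (S' := S⁻¹.submatrix (Equiv.refl _) Equiv.ulift)
    (T := T.submatrix Equiv.ulift (Equiv.refl _)) (T' := T⁻¹.submatrix (Equiv.refl _) Equiv.ulift)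
    (by rw [Matrix.submatrix_mul_equiv, Matrix.mul_nonsing_inv _ hSu, Matrix.submatrix_one_equiv])
    (by rw [Matrix.submatrix_mul_equiv, Matrix.nonsing_inv_mul _ hSu]; rfl)
    (by rw [Matrix.submatrix_mul_equiv, Matrix.mul_nonsing_inv _ hTu, Matrix.submatrix_one_equiv])
    (by rw [Matrix.submatrix_mul_equiv, Matrix.nonsing_inv_mul _ hTu]; rfl)
    (fun a b x hx => by
      have h1 := hdom _ _ _ (mk_mem_factorizationCone a b hx)
      rw [hfrob, hfrob, hS, hT]
      have h2 := mul_nonneg hε.le (hnn a)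
      have h3 := mul_nonneg hε.le (hnn b)
      linarith)
  refine ⟨_, ⟨EuclideanSpace ℂ (ULift.{w} (Fin m)), inferInstance, inferInstance, inferInstance,
    Φ, hΦ, rfl⟩, ?_⟩
  rw [← hXh, hΦh]
  set η := conjColumns (S.submatrix (Equiv.ulift.{w} : ULift.{w} (Fin m) ≃ Fin m) (Equiv.refl _))
  set ξ := conjColumns (T.submatrix (Equiv.ulift.{w} : ULift.{w} (Fin m) ≃ Fin m) (Equiv.refl _))
  have hη : ‖η‖ ^ 2 = p 1 + ε * m := by
    have h1 := hS (1 : Matrix (Fin m) (Fin m) ℂ)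
    rw [← hfrob, Matrix.mul_one, frobeniusSq_one] at h1
    rw [norm_sq_conjColumns, h1]
    simp
  have hξ : ‖ξ‖ ^ 2 = q 1 + ε * m := by
    have h1 := hT (1 : Matrix (Fin m) (Fin m) ℂ)
    rw [← hfrob, Matrix.mul_one, frobeniusSq_one] at h1
    rw [norm_sq_conjColumns, h1]
    simp
  -- The arithmetic–geometric mean inequality with p(1) + q(1) = 2.
  have h4 : ‖η‖ * ‖ξ‖ ≤ 1 + ε * m := by nlinarith [sq_nonneg (‖η‖ - ‖ξ‖)]
  calc (inner ℂ η (opMatrix (X.map Φ) ξ)).re ≤ ‖η‖ * (‖opMatrix (X.map Φ)‖ * ‖ξ‖) := by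
        refine (Complex.re_le_norm _).trans ((norm_inner_le_norm _ _).trans ?_)
        gcongr
        exact ContinuousLinearMap.le_opNorm _ _
    _ = ‖opMatrix (X.map Φ)‖ * (‖η‖ * ‖ξ‖) := by ring
    _ ≤ _ := by gcongr

theorem bddAbove_kMaxValues {k : ℕ} (hk : 1 ≤ k) {m : ℕ} (X : Matrix (Fin m) (Fin m) V) :
    BddAbove (kMaxValues.{u, w} k X) := by
  obtain ⟨d, hd⟩ := factorizationValues_nonempty hk X
  exact ⟨d, fun c hc => le_of_mem_kMaxValues_of_mem_factorizationValues hc hd⟩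

theorem sInf_factorizationValues_le_kMaxNorm {k : ℕ} (hk : 1 ≤ k) {m : ℕ}
    (X : Matrix (Fin m) (Fin m) V) : sInf (factorizationValues k X) ≤ kMaxNorm.{u, w} k X := by
  have hbdd := bddAbove_kMaxValues.{u, w} hk X
  have h0 : 0 ≤ kMaxNorm.{u, w} k X := le_csSup hbdd (zero_mem_kMaxValues k X)
  -- The separating plane degenerates at X = 0, where the trivial factorization has value 0.
  rcases eq_or_ne X 0 with rfl | hX
  · refine (csInf_le (bddBelow_factorizationValues k _) ?_).trans h0
    refine ⟨1, le_rfl, 0, 0, 0, fun s => ?_, ?_, by simp⟩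
    · rw [Pi.zero_apply, (OperatorSpace.matNorm_eq_zero_iff k 0).2 rfl]
      exact zero_le_one
    · rw [sandwich_zero_left]
  · have key : ∀ ε : ℝ, 0 < ε → sInf (factorizationValues k X) ≤
        kMaxNorm.{u, w} k X + ε * (kMaxNorm.{u, w} k X * m) := fun ε hε => by
      obtain ⟨c, hc, hle⟩ := exists_mem_kMaxValues_sInf_le.{u, w} hk hX hε
      have h1 : c ≤ kMaxNorm.{u, w} k X := le_csSup hbdd hc
      have h2 : c * (1 + ε * m) ≤ kMaxNorm.{u, w} k X * (1 + ε * m) := by gcongr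
      linarith
    have hlim : Filter.Tendsto (fun ε : ℝ => kMaxNorm.{u, w} k X + ε * (kMaxNorm.{u, w} k X * m))
        (nhdsWithin 0 (Set.Ioi 0)) (nhds (kMaxNorm.{u, w} k X)) := by
      refine Filter.Tendsto.mono_left ?_ nhdsWithin_le_nhds
      have : Continuous fun ε : ℝ => kMaxNorm.{u, w} k X + ε * (kMaxNorm.{u, w} k X * m) := by
        fun_prop
      simpa using this.tendsto 0
    exact ge_of_tendsto hlim (Filter.eventually_of_mem self_mem_nhdsWithin key)

end Main

end

theorem theorem3p3 {V : Type u} [AddCommGroup V] [Module ℂ V] [OperatorSpace V]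
    (k : ℕ) (hk : 1 ≤ k) (m : ℕ) (X : Matrix (Fin m) (Fin m) V) :
    BddAbove (kMaxValues.{u, w} k X) ∧ (factorizationValues k X).Nonempty ∧
      kMaxNorm.{u, w} k X = sInf (factorizationValues k X) := by
  refine ⟨bddAbove_kMaxValues hk X, factorizationValues_nonempty hk X, le_antisymm ?_
    (sInf_factorizationValues_le_kMaxNorm hk X)⟩
  refine csSup_le ⟨0, zero_mem_kMaxValues k X⟩ fun c hc => ?_
  exact le_csInf (factorizationValues_nonempty hk X) fun d hd =>
    le_of_mem_kMaxValues_of_mem_factorizationValues hc hd
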